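/- **Setting.** Let $N\ge 1$ agents play a Markov game with finite state space $\mathcal S$, finite action spaces $\mathcal A^{(1)},\dots,\mathcal A^{(N)}$, transition law $P(s'\mid s,a)$, initial law $\rho_0$ and discount factor $\gamma\in[0,1)$. Write $a=(a^{(1)},\dots,a^{(N)})$ for joint actions, and fix an agent $i$; $a^{(-i)}$ denotes the joint action of the other agents. A policy of agent $i$ is a family of distributions $\pi^{(i)}(a^{(i)}\mid s,a^{(-i)})$, and the opponents have a joint policy $\pi^{(-i)}(a^{(-i)}\mid s)$; together they define the joint policy $\pi(a\mid s)=\pi^{(i)}(a^{(i)}\mid s,a^{(-i)})\,\pi^{(-i)}(a^{(-i)}\mid s)$. The set $\Pi^{(i)}$ of available policies of agent $i$ is either the set of all such $\pi^{(i)}$ (correlated case) or the set of those that do not depend on $a^{(-i)}$ (non-correlated case). For a joint policy $\pi$ and $f:\mathcal S\times\mathcal A^{(1)}\times\cdots\times\mathcal A^{(N)}\to\mathbb R$ put $$\mathbb E_\pi[f]=\mathbb E\Big[\sum_{t\ge0}\gamma^t f(s_t,a_t)\Big],\qquad \rho_\pi(s,a)=\pi(a\mid s)\sum_{t\ge0}\gamma^tP(s_t=s\mid\pi).$$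 Let $\pi_E=(\pi_E^{(i)},\pi_E^{(-i)})$ be the demonstrators' joint policy, where $\pi_E^{(i)}(a^{(i)}\mid s,a^{(-i)})$ is arbitrary. Let $\lambda>0$, and let $$H(\pi^{(i)})=\mathbb E_{\pi^{(i)},\pi_E^{(-i)}}\big[-\log\pi^{(i)}(a^{(i)}\mid s,a^{(-i)})\big]$$ be the $\gamma$-discounted causal entropy. Let $\psi:\mathbb R^{\mathcal S\times\mathcal A^{(1)}\times\cdots\times\mathcal A^{(N)}}\to\mathbb R\cup\{\infty\}$ be convex and not identically $\infty$, with conjugate $\psi^*(x)=\sup_r\,\langle x,r\rangle-\psi(r)$. Define $$\mathrm{RL}^{(i)}(r)=\operatorname*{argmax}_{\pi^{(i)}\in\Pi^{(i)}}\ \lambda H(\pi^{(i)})+\mathbb E_{\pi^{(i)},\pi_E^{(-i)}}[r],$$ $$\mathrm{IRL}^{(i)}_\psi=\operatorname*{argmax}_{r}\ g_\psi(r),\qquad g_\psi(r)=-\psi(r)-\max_{\pi^{(i)}\in\Pi^{(i)}}\big(\lambda H(\pi^{(i)})+\mathbb E_{\pi^{(i)},\pi_E^{(-i)}}[r]\big)+\mathbb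 E_{\pi_E}[r],$$ where $r$ ranges over all real functions on $\mathcal S\times\mathcal A^{(1)}\times\cdots\times\mathcal A^{(N)}$, and let $$F_\psi(\pi^{(i)})=-\lambda H(\pi^{(i)})+\psi^*\big(\rho_{\pi_E}-\rho_{\pi^{(i)},\pi_E^{(-i)}}\big).$$ **Proposition 1.** (a) IRL is the Lagrangian dual of the occupancy measure matching problem $\min_{\pi^{(i)}\in\Pi^{(i)}}F_\psi(\pi^{(i)})$, without duality gap: with $L(\pi^{(i)},r)=-\lambda H(\pi^{(i)})-\psi(r)+\mathbb E_{\pi_E}[r]-\mathbb E_{\pi^{(i)},\pi_E^{(-i)}}[r]$, $$g_\psi(r)=\inf_{\pi^{(i)}\in\Pi^{(i)}}L(\pi^{(i)},r)\ \text{ for every } r,\qquad F_\psi(\pi^{(i)})=\sup_rL(\pi^{(i)},r)\ \text{ for every }\pi^{(i)}\in\Pi^{(i)},\qquad \sup_r g_\psi(r)=\inf_{\pi^{(i)}\in\Pi^{(i)}}F_\psi(\pi^{(i)}).$$ Moreover $\mathrm{RL}^{(i)}(r)\neq\emptyset$ for every $r$, and the minimum of $F_\psi$ over $\Pi^{(i)}$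 is attained. (b) The policies learned by RL on a reward recovered by IRL are exactly the primal optima: for every $r\in\mathrm{IRL}^{(i)}_\psi$, $$\mathrm{RL}^{(i)}(r)=\operatorname*{argmin}_{\pi^{(i)}\in\Pi^{(i)}}\ -\lambda H(\pi^{(i)})+\psi^*\big(\rho_{\pi_E}-\rho_{\pi^{(i)},\pi_E^{(-i)}}\big).$$ (c) If instead $\psi$ regularizes the cost $-r$, that is, $\psi(r)$ is replaced by $\psi(-r)$ in the IRL objective, then for every maximizer $r$ of that objective, $$\mathrm{RL}^{(i)}(r)=\operatorname*{argmin}_{\pi^{(i)}\in\Pi^{(i)}}\ -\lambda H(\pi^{(i)})+\psi^*\big(\rho_{\pi^{(i)},\pi_E^{(-i)}}-\rho_{\pi_E}\big).$$ -/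

import Mathlib

noncomputable section

namespace CoIRL

/-- The dynamics of a discounted Markov game with agents `Fin N`, state space `S` and action space
`A j` for agent `j`: transition law, initial law and discount factor. The reward of an agent is not
part of it, since rewards are the variable of the problems below. -/
structure MarkovGame {N : ℕ} (S : Type*) (A : Fin N → Type*) [Fintype S] where
  /-- `trans s a s'` is the probability of moving from `s` to `s'` under the joint action `a`. -/
  trans : S → (∀ j, A j) → stdSimplex ℝ S
  init : stdSimplex ℝ S
  disc : ℝ
  disc_nonneg : 0 ≤ disc
  disc_lt_one : disc < 1

section Policies

variable {N : ℕ} (S : Type*) (A : Fin N → Type*) (i : Fin N)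

/-- Joint actions of all agents except `i`. -/
abbrev OppAction : Type _ := ∀ j : {j : Fin N // j ≠ i}, A j

/-- Policies of agent `i` in conditional (correlated) form: `π s b` is the distribution of the
action of agent `i` given the state `s` and the joint action `b` of its opponents. -/
abbrev Policy [Fintype (A i)] : Type _ := S → OppAction A i → stdSimplex ℝ (A i)

/-- Joint policies of the opponents of agent `i`. -/
abbrev OppPolicy [∀ j, Fintype (A j)] : Type _ := S → stdSimplex ℝ (OppAction A i)

/-- Rewards: real functions of the state and the joint action. -/
abbrev Reward : Type _ := S → (∀ j, A j) → ℝ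

/-- The policy class of the correlated setting: all conditional policies. -/
def correlatedPolicies [Fintype (A i)] : Set (Policy S A i) := Set.univ

/-- The policy class of the non-correlated setting: policies that do not look at the action of the
opponents, i.e. that are of the form `π(aᵢ | s)`. -/
def nonCorrelatedPolicies [Fintype (A i)] : Set (Policy S A i) :=
  {π | ∀ s b b', π s b = π s b'}

end Policies

section Definitions

variable {N : ℕ} {S : Type*} {A : Fin N → Type*} {i : Fin N} [Fintype S] [∀ j, Fintype (A j)]

/-- The actions of the opponents of agent `i` in a joint action. -/
def oppOf (i : Fin N) (a : ∀ j, A j) : OppAction A i := fun j => a j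

/-- The joint policy `π(aᵢ, a₋ᵢ | s) = π(aᵢ | s, a₋ᵢ) μ(a₋ᵢ | s)`. -/
def joint (π : Policy S A i) (μ : OppPolicy S A i) (s : S) (a : ∀ j, A j) : ℝ :=
  (π s (oppOf i a) : A i → ℝ) (a i) * (μ s : OppAction A i → ℝ) (oppOf i a)

/-- `P(sₜ = s)` when all agents follow the joint policy `p`. -/
def stateProb (G : MarkovGame S A) (p : S → (∀ j, A j) → ℝ) : ℕ → S → ℝ
  | 0 => fun s => (G.init : S → ℝ) s
  | t + 1 => fun s' =>
      ∑ s, ∑ a, stateProb G p t s * p s a * (G.trans s a : S → ℝ) s'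

/-- The discounted expectation `𝔼_p [f] = 𝔼 [∑ₜ γᵗ f(sₜ, aₜ)]` under the joint policy `p`. -/
def expect (G : MarkovGame S A) (p : S → (∀ j, A j) → ℝ) (f : S → (∀ j, A j) → ℝ) : ℝ :=
  ∑' t : ℕ, G.disc ^ t * ∑ s, ∑ a, stateProb G p t s * p s a * f s a

/-- The occupancy measure `ρ_p(s, a) = p(a | s) ∑ₜ γᵗ P(sₜ = s)`. -/
def occupancy (G : MarkovGame S A) (p : S → (∀ j, A j) → ℝ) : S → (∀ j, A j) → ℝ :=
  fun s a => p s a * ∑' t : ℕ, G.disc ^ t * stateProb G p t s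

/-- The `γ`-discounted causal entropy `𝔼_{π, μ} [-log π(aᵢ | s, a₋ᵢ)]` of the policy `π` of
agent `i`, played against opponents `μ`. -/
def entropy (G : MarkovGame S A) (μ : OppPolicy S A i) (π : Policy S A i) : ℝ :=
  expect G (joint π μ) (fun s a => -Real.log ((π s (oppOf i a) : A i → ℝ) (a i)))

/-- The objective of entropy-regularized reinforcement learning against opponents `μ`. -/
def rlObjective (G : MarkovGame S A) (lam : ℝ) (μ : OppPolicy S A i) (r : Reward S A)
    (π : Policy S A i) : ℝ :=
  lam * entropy G μ π + expect G (joint π μ) r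

/-- `RL(r)`: the policies in the class `C` that maximize the objective for the reward `r`. -/
def RL (G : MarkovGame S A) (lam : ℝ) (μ : OppPolicy S A i) (C : Set (Policy S A i))
    (r : Reward S A) : Set (Policy S A i) :=
  {π | π ∈ C ∧ ∀ π' ∈ C, rlObjective G lam μ r π' ≤ rlObjective G lam μ r π}

/-- The objective of inverse reinforcement learning from the demonstrator `(πE, μE)`:
`-ψ(r) - max_π (λ H(π) + 𝔼_{π, μE} [r]) + 𝔼_{πE, μE} [r]`. -/
def irlObjective (G : MarkovGame S A) (lam : ℝ) (πE : Policy S A i) (μE : OppPolicy S A i)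
    (C : Set (Policy S A i)) (ψ : Reward S A → EReal) (r : Reward S A) : EReal :=
  -ψ r - (⨆ π ∈ C, ((rlObjective G lam μE r π : ℝ) : EReal))
    + ((expect G (joint πE μE) r : ℝ) : EReal)

/-- `IRL_ψ`: the rewards that maximize the objective of inverse reinforcement learning. -/
def IRL (G : MarkovGame S A) (lam : ℝ) (πE : Policy S A i) (μE : OppPolicy S A i)
    (C : Set (Policy S A i)) (ψ : Reward S A → EReal) : Set (Reward S A) :=
  {r | ∀ r', irlObjective G lam πE μE C ψ r' ≤ irlObjective G lam πE μE C ψ r}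

/-- The convex conjugate `ψ*(x) = sup_r (⟨x, r⟩ - ψ(r))`. -/
def conjugate (ψ : Reward S A → EReal) (x : S → (∀ j, A j) → ℝ) : EReal :=
  ⨆ r : Reward S A, ((∑ s, ∑ a, x s a * r s a : ℝ) : EReal) - ψ r

/-- The objective `-λ H(π) + ψ*(ρ_E - ρ_{π, μE})` of occupancy measure matching with a
regularizer `ψ` of the reward. -/
def matchObjective (G : MarkovGame S A) (lam : ℝ) (πE : Policy S A i) (μE : OppPolicy S A i)
    (ψ : Reward S A → EReal) (π : Policy S A i) : EReal :=
  ((-(lam * entropy G μE π) : ℝ) : EReal)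
    + conjugate ψ (occupancy G (joint πE μE) - occupancy G (joint π μE))

/-- The objective `-λ H(π) + ψ*(ρ_{π, μE} - ρ_E)` of occupancy measure matching with a
regularizer `ψ` of the cost, i.e. of the negative reward. -/
def costMatchObjective (G : MarkovGame S A) (lam : ℝ) (πE : Policy S A i) (μE : OppPolicy S A i)
    (ψ : Reward S A → EReal) (π : Policy S A i) : EReal :=
  ((-(lam * entropy G μE π) : ℝ) : EReal)
    + conjugate ψ (occupancy G (joint π μE) - occupancy G (joint πE μE))

/-- The Lagrangian `-λ H(π) - ψ(r) + 𝔼_{πE, μE} [r] - 𝔼_{π, μE} [r]`. -/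
def lagrangian (G : MarkovGame S A) (lam : ℝ) (πE : Policy S A i) (μE : OppPolicy S A i)
    (ψ : Reward S A → EReal) (π : Policy S A i) (r : Reward S A) : EReal :=
  ((-(lam * entropy G μE π) + expect G (joint πE μE) r - expect G (joint π μE) r : ℝ) : EReal)
    - ψ r

/-- The optimal value of inverse reinforcement learning (the dual value). -/
def irlValue (G : MarkovGame S A) (lam : ℝ) (πE : Policy S A i) (μE : OppPolicy S A i)
    (C : Set (Policy S A i)) (ψ : Reward S A → EReal) : EReal :=
  ⨆ r, irlObjective G lam πE μE C ψ r

/-- The optimal value of occupancy measure matching (the primal value). -/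
def matchValue (G : MarkovGame S A) (lam : ℝ) (πE : Policy S A i) (μE : OppPolicy S A i)
    (C : Set (Policy S A i)) (ψ : Reward S A → EReal) : EReal :=
  ⨅ π ∈ C, matchObjective G lam πE μE ψ π

/-- The minimizers of `f` over the policy class `C`. -/
def argminOver (C : Set (Policy S A i)) (f : Policy S A i → EReal) : Set (Policy S A i) :=
  {π | π ∈ C ∧ ∀ π' ∈ C, f π ≤ f π'}

/-- Proper convex functions with values in `ℝ ∪ {∞}`; convexity is convexity of the epigraph. -/
structure IsProperConvex (ψ : Reward S A → EReal) : Prop where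
  ne_bot : ∀ r, ψ r ≠ ⊥
  exists_ne_top : ∃ r, ψ r ≠ ⊤
  convex_epigraph : Convex ℝ {q : Reward S A × ℝ | ψ q.1 ≤ (q.2 : EReal)}

end Definitions

end CoIRL

end

/-! Everything happens on occupancy measures. Two policies `π₀`, `π₁` of agent `i` can be mixed, at
each state in proportion to the visit frequencies `(1 - t) d₀(s)` and `t d₁(s)`; by uniqueness of
the solution of the Bellman flow equation, the result has the occupancy measure `(1 - t) ρ₀ + t ρ₁`
(`exists_isMixture`). The weights depend on the state only, so that both policy classes are closed
under this operation (`IsMixingClass`), and no case distinction is needed afterwards. Expected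
rewards are linear along such a mixture, and the causal entropy is concave, as an average of values
of the concave function `negMulLog` (`IsMixture.le_entropy`).

The Lagrangian is therefore convexlike and continuous in the policy, which ranges over a compact
set, and concave in the reward. A minimax theorem that needs no topology on the rewards
(`exists_forall_le_of_convexlike`) excludes a duality gap, with no semicontinuity assumption
on `ψ`. Primal optima exist because the primal objective is a supremum of functions continuous in
the policy.

If `r` is a recovered reward, then any primal optimum `π` and `r` form a saddle point, whence
`π ∈ RL(r)`. Conversely, `negMulLog` is strictly concave, so that any two elements of `RL(r)` agree
after every event that has positive probability under both (`IsMixture.eq_of_entropy_le`). They need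
not be equal, but they induce the same occupancy measure and the same entropy, on which alone the
primal objective depends: if one of them is a primal optimum, so are all. Regularizing the cost
amounts to replacing `ψ` by the proper convex function `r ↦ ψ (-r)`. -/

/-! ### A minimax theorem -/

/-- **Minimax alternative.** Let `l` be continuous on a compact set `C` in the first variable and
concave on `D` in the second one, and *convexlike* in the first one: for two points of `C` and a
weight there is a point of `C` whose value is at most the weighted mean, whatever the second
variable is. If `α` is below `⨆ r, l x r` at each `x ∈ C`, then one `r` achieves `α ≤ l x r` for
all `x ∈ C`. By compactness finitely many `r` suffice, and separating the values at these from the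
orthant below `α` in a finite-dimensional space yields the weights with which to average them. -/
theorem exists_forall_le_of_convexlike {X E : Type*} [TopologicalSpace X] [AddCommGroup E]
    [Module ℝ E] {C : Set X} (hC : IsCompact C) (hCne : C.Nonempty) {D : Set E}
    {l : X → E → ℝ} (hcont : ∀ r ∈ D, ContinuousOn (fun x => l x r) C)
    (hconc : ∀ x ∈ C, ConcaveOn ℝ D (l x))
    (hconv : ∀ x ∈ C, ∀ y ∈ C, ∀ t : ℝ, 0 ≤ t → t ≤ 1 →
      ∃ z ∈ C, ∀ r ∈ D, l z r ≤ (1 - t) * l x r + t * l y r)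
    {α : ℝ} (hα : ∀ x ∈ C, ∃ r ∈ D, α < l x r) :
    ∃ r ∈ D, ∀ x ∈ C, α ≤ l x r := by
  classical
  obtain ⟨T, hTD, hT⟩ : ∃ T : Finset E, (∀ r ∈ T, r ∈ D) ∧ ∀ x ∈ C, ∃ r ∈ T, α < l x r := by
    refine hC.induction_on (p := fun K => ∃ T : Finset E, (∀ r ∈ T, r ∈ D) ∧
      ∀ x ∈ K, ∃ r ∈ T, α < l x r) ⟨∅, by simp, by simp⟩ ?_ ?_ ?_
    · rintro s t hst ⟨T, h1, h2⟩
      exact ⟨T, h1, fun x hx => h2 x (hst hx)⟩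
    · rintro s t ⟨T, h1, h2⟩ ⟨T', h1', h2'⟩
      refine ⟨T ∪ T', fun r hr => (Finset.mem_union.1 hr).elim (h1 r) (h1' r), ?_⟩
      rintro x (hx | hx)
      · obtain ⟨r, hr, h⟩ := h2 x hx
        exact ⟨r, Finset.mem_union_left _ hr, h⟩
      · obtain ⟨r, hr, h⟩ := h2' x hx
        exact ⟨r, Finset.mem_union_right _ hr, h⟩
    · intro x hx
      obtain ⟨r, hr, h⟩ := hα x hx
      exact ⟨_, (hcont r hr x hx).eventually_const_lt h, {r}, by simpa using hr,
        fun y hy => ⟨r, by simp, hy⟩⟩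
  let U : Set (T → ℝ) := {z | ∀ j, z j < α}
  let V : Set (T → ℝ) := {z | ∃ x ∈ C, ∀ j : T, l x j ≤ z j}
  have hUc : Convex ℝ U := by
    have : U = Set.pi Set.univ fun _ => Set.Iio α := by ext; simp [U]
    rw [this]
    exact convex_pi fun _ _ => convex_Iio α
  have hUo : IsOpen U := by
    have : U = Set.pi Set.univ fun _ => Set.Iio α := by ext; simp [U]
    rw [this]
    exact isOpen_set_pi Set.finite_univ fun _ _ => isOpen_Iio
  have hVc : Convex ℝ V := by
    rintro z ⟨x, hx, hz⟩ z' ⟨y, hy, hz'⟩ a b ha hb hab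
    obtain ⟨w, hw, h⟩ := hconv x hx y hy b hb (by linarith)
    refine ⟨w, hw, fun j => (h j (hTD j j.2)).trans ?_⟩
    have ha' : 1 - b = a := by linarith
    simp only [Pi.add_apply, Pi.smul_apply, smul_eq_mul, ha']
    exact add_le_add (mul_le_mul_of_nonneg_left (hz j) ha) (mul_le_mul_of_nonneg_left (hz' j) hb)
  have hdisj : Disjoint U V := by
    rw [Set.disjoint_left]
    rintro z hz ⟨x, hx, hzx⟩
    obtain ⟨r, hr, h⟩ := hT x hx
    exact absurd (hz ⟨r, hr⟩) (not_lt.2 (h.le.trans (hzx ⟨r, hr⟩)))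
  obtain ⟨f, u, hfU, hfV⟩ := geometric_hahn_banach_open hUc hUo hVc hdisj
  let w : T → ℝ := fun j => f (Pi.single j 1)
  have hf : ∀ z, f z = ∑ j, w j * z j := by
    intro z
    conv_lhs => rw [pi_eq_sum_univ' z]
    rw [map_sum]
    refine Finset.sum_congr rfl fun j _ => ?_
    rw [map_smul, smul_eq_mul, mul_comm]
  obtain ⟨x₀, hx₀⟩ := hCne
  -- `V` is closed under increasing a coordinate, so that a negative weight would make `f`
  -- unbounded below on it
  have hw : ∀ j, 0 ≤ w j := by
    intro j
    by_contra! hneg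
    let v : T → ℝ := fun k => l x₀ k
    obtain ⟨n, hn⟩ := exists_nat_gt ((f v - u) / -w j)
    have hv : v + (n : ℝ) • Pi.single j 1 ∈ V := by
      refine ⟨x₀, hx₀, fun k : T => ?_⟩
      have : (0 : ℝ) ≤ (Pi.single j 1 : T → ℝ) k := by
        rw [Pi.single_apply]; split_ifs <;> norm_num
      simp only [Pi.add_apply, Pi.smul_apply, smul_eq_mul, v]
      have := mul_nonneg (Nat.cast_nonneg (α := ℝ) n) this
      linarith
    have h := hfV _ hv
    rw [map_add, map_smul, smul_eq_mul] at h
    change u ≤ f v + n * w j at h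
    rw [div_lt_iff₀ (by linarith)] at hn
    linarith
  have hαu : ∀ ε > 0, (α - ε) * ∑ j, w j < u := by
    intro ε hε
    have := hfU (fun _ => α - ε) fun j => by linarith
    rwa [hf, ← Finset.sum_mul, mul_comm] at this
  have hW : 0 < ∑ j, w j := by
    refine (Finset.sum_nonneg fun j _ => hw j).lt_of_ne fun h => ?_
    have hz : ∀ j, w j = 0 := fun j =>
      (Finset.sum_eq_zero_iff_of_nonneg fun j _ => hw j).1 h.symm j (Finset.mem_univ j)
    have h1 := hαu 1 one_pos
    have h2 := hfV (fun k => l x₀ k) ⟨x₀, hx₀, fun _ => le_rfl⟩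
    rw [hf] at h2
    simp only [hz, zero_mul, Finset.sum_const_zero, mul_zero] at h1 h2
    linarith
  have hαu' : α * ∑ j, w j ≤ u := by
    refine le_of_forall_pos_lt_add fun ε hε => ?_
    have := hαu (ε / ∑ j, w j) (by positivity)
    rw [sub_mul, div_mul_cancel₀ _ hW.ne'] at this
    linarith
  have hw1 : ∑ j, w j / ∑ k, w k = 1 := by rw [← Finset.sum_div, div_self hW.ne']
  have hw0 : ∀ j ∈ Finset.univ, 0 ≤ w j / ∑ k, w k := fun j _ => div_nonneg (hw j) hW.le
  refine ⟨∑ j, (w j / ∑ k, w k) • (j : E),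
    (hconc x₀ hx₀).1.sum_mem hw0 hw1 fun j _ => hTD j j.2, fun x hx => ?_⟩
  refine le_trans ?_ ((hconc x hx).le_map_sum hw0 hw1 fun j _ => hTD j j.2)
  have h := hαu'.trans (hfV (fun k => l x k) ⟨x, hx, fun _ => le_rfl⟩)
  rw [hf] at h
  calc α ≤ (∑ j, w j * l x j) / ∑ k, w k := by rwa [le_div_iff₀ hW]
    _ = ∑ j, (w j / ∑ k, w k) • l x j := by
      rw [Finset.sum_div]
      exact Finset.sum_congr rfl fun j _ => by rw [smul_eq_mul]; ring

noncomputable section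

namespace CoIRL

open Finset

variable {N : ℕ} {S : Type*} {A : Fin N → Type*} {i : Fin N} [Fintype S] [∀ j, Fintype (A j)]

/-! ### Discounted visit frequencies of a stationary policy -/

/-- A stationary joint policy as a kernel: `p s` is a distribution on joint actions. -/
structure IsKernel (p : S → (∀ j, A j) → ℝ) : Prop where
  nonneg : ∀ s a, 0 ≤ p s a
  sum_eq_one : ∀ s, ∑ a, p s a = 1

/-- The discounted visit frequency `∑ₜ γᵗ P(sₜ = s)` of the state `s`. -/
def visits (G : MarkovGame S A) (p : S → (∀ j, A j) → ℝ) (s : S) : ℝ :=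
  ∑' t : ℕ, G.disc ^ t * stateProb G p t s

lemma occupancy_apply (G : MarkovGame S A) (p : S → (∀ j, A j) → ℝ) (s : S) (a : ∀ j, A j) :
    occupancy G p s a = p s a * visits G p s := rfl

section Kernel

variable {G : MarkovGame S A} {p : S → (∀ j, A j) → ℝ}

lemma stateProb_nonneg (hp : IsKernel p) (t : ℕ) (s : S) : 0 ≤ stateProb G p t s := by
  induction t generalizing s with
  | zero => exact G.init.2.1 s
  | succ t ih =>
    exact sum_nonneg fun x _ => sum_nonneg fun a _ =>
      mul_nonneg (mul_nonneg (ih x) (hp.nonneg x a)) ((G.trans x a).2.1 s)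

lemma sum_stateProb (hp : IsKernel p) (t : ℕ) : ∑ s, stateProb G p t s = 1 := by
  induction t with
  | zero => exact G.init.2.2
  | succ t ih =>
    calc ∑ s', ∑ s, ∑ a, stateProb G p t s * p s a * (G.trans s a : S → ℝ) s'
        = ∑ s, ∑ a, stateProb G p t s * p s a * ∑ s', (G.trans s a : S → ℝ) s' := by
          rw [sum_comm]
          refine sum_congr rfl fun s _ => ?_
          rw [sum_comm]
          exact sum_congr rfl fun a _ => (mul_sum _ _ _).symm
      _ = ∑ s, stateProb G p t s := by
          refine sum_congr rfl fun s _ => ?_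
          simp_rw [stdSimplex.sum_eq_one, mul_one, ← mul_sum, hp.sum_eq_one s, mul_one]
      _ = 1 := ih

lemma stateProb_le_one (hp : IsKernel p) (t : ℕ) (s : S) : stateProb G p t s ≤ 1 := by
  rw [← sum_stateProb (G := G) hp t]
  exact single_le_sum (fun x _ => stateProb_nonneg hp t x) (mem_univ s)

lemma norm_disc_pow_mul_stateProb_le (hp : IsKernel p) (t : ℕ) (s : S) :
    ‖G.disc ^ t * stateProb G p t s‖ ≤ G.disc ^ t := by
  have h := pow_nonneg G.disc_nonneg t
  rw [Real.norm_eq_abs, abs_of_nonneg (mul_nonneg h (stateProb_nonneg hp t s))]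
  exact mul_le_of_le_one_right h (stateProb_le_one hp t s)

omit [∀ j, Fintype (A j)] in
lemma summable_disc_pow (G : MarkovGame S A) : Summable fun t : ℕ => G.disc ^ t :=
  summable_geometric_of_lt_one G.disc_nonneg G.disc_lt_one

lemma summable_visits (hp : IsKernel p) (s : S) :
    Summable fun t : ℕ => G.disc ^ t * stateProb G p t s :=
  .of_norm_bounded (summable_disc_pow G) fun t => norm_disc_pow_mul_stateProb_le hp t s

lemma visits_nonneg (hp : IsKernel p) (s : S) : 0 ≤ visits G p s :=
  tsum_nonneg fun t => mul_nonneg (pow_nonneg G.disc_nonneg t) (stateProb_nonneg hp t s)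

/-- Interchange of the sum over time with finite sums over states. -/
lemma hasSum_visits_mul (hp : IsKernel p) (c : S → ℝ) :
    HasSum (fun t : ℕ => G.disc ^ t * ∑ s, stateProb G p t s * c s) (∑ s, visits G p s * c s) := by
  have h := hasSum_sum (s := univ) fun s _ => (summable_visits (G := G) hp s).hasSum.mul_right (c s)
  refine h.congr_fun ?_
  intro t
  rw [mul_sum]
  exact sum_congr rfl fun s _ => by ring

lemma expect_eq_sum_visits (hp : IsKernel p) (f : S → (∀ j, A j) → ℝ) :
    expect G p f = ∑ s, visits G p s * ∑ a, p s a * f s a := by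
  rw [← (hasSum_visits_mul hp _).tsum_eq]
  refine tsum_congr fun t => ?_
  congr 1
  refine sum_congr rfl fun s _ => ?_
  rw [mul_sum]
  exact sum_congr rfl fun a _ => by ring

lemma expect_eq_sum_occupancy (hp : IsKernel p) (f : S → (∀ j, A j) → ℝ) :
    expect G p f = ∑ s, ∑ a, occupancy G p s a * f s a := by
  rw [expect_eq_sum_visits hp]
  refine sum_congr rfl fun s _ => ?_
  rw [mul_sum]
  exact sum_congr rfl fun a _ => by rw [occupancy_apply]; ring

/-- The Bellman flow equation. -/
lemma visits_flow (hp : IsKernel p) (s' : S) :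
    visits G p s' = (G.init : S → ℝ) s'
      + G.disc * ∑ s, visits G p s * ∑ a, p s a * (G.trans s a : S → ℝ) s' := by
  rw [visits, (summable_visits hp s').tsum_eq_zero_add, pow_zero, one_mul,
    ← ((hasSum_visits_mul (G := G) hp _).mul_left G.disc).tsum_eq]
  congr 1
  refine tsum_congr fun t => ?_
  rw [pow_succ, mul_comm (G.disc ^ t), mul_assoc]
  congr 2
  refine sum_congr rfl fun s _ => ?_
  rw [mul_sum]
  exact sum_congr rfl fun a _ => by ring

/-- The Bellman flow equation determines the visit frequencies: the difference of two solutions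
is a fixed point of a map that contracts the `ℓ¹` norm by the factor `γ < 1`. -/
lemma eq_visits_of_flow (hp : IsKernel p) {d : S → ℝ}
    (hd : ∀ s', d s' = (G.init : S → ℝ) s'
      + G.disc * ∑ s, d s * ∑ a, p s a * (G.trans s a : S → ℝ) s') :
    visits G p = d := by
  let y : S → ℝ := fun s => visits G p s - d s
  have hy : ∀ s', y s' = G.disc * ∑ s, y s * ∑ a, p s a * (G.trans s a : S → ℝ) s' := by
    intro s'
    simp only [y, sub_mul, sum_sub_distrib]
    rw [mul_sub]
    linarith [hd s', visits_flow (G := G) hp s']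
  have hle : ∑ s', |y s'| ≤ G.disc * ∑ s, |y s| := by
    calc ∑ s', |y s'| ≤ ∑ s', G.disc * ∑ s, |y s| * ∑ a, p s a * (G.trans s a : S → ℝ) s' := by
          refine sum_le_sum fun s' _ => ?_
          conv_lhs => rw [hy s', abs_mul, abs_of_nonneg G.disc_nonneg]
          refine mul_le_mul_of_nonneg_left ((abs_sum_le_sum_abs _ _).trans_eq ?_) G.disc_nonneg
          refine sum_congr rfl fun s _ => ?_
          rw [abs_mul, abs_of_nonneg (sum_nonneg fun a _ =>
            mul_nonneg (hp.nonneg s a) (stdSimplex.zero_le (G.trans s a) s'))]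
      _ = G.disc * ∑ s, |y s| := by
          rw [← mul_sum, sum_comm]
          congr 1
          refine sum_congr rfl fun s _ => ?_
          rw [← mul_sum, sum_comm]
          simp_rw [← mul_sum]
          simp_rw [stdSimplex.sum_eq_one, mul_one, hp.sum_eq_one s, mul_one]
  have h0 : ∑ s, |y s| = 0 := by
    have := sum_nonneg fun s (_ : s ∈ univ) => abs_nonneg (y s)
    nlinarith [G.disc_lt_one]
  funext s
  have := (sum_eq_zero_iff_of_nonneg fun s _ => abs_nonneg (y s)).1 h0 s (mem_univ s)
  exact sub_eq_zero.1 (abs_eq_zero.1 this)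

/-- Kernels that agree at the states visited by both have equal visit frequencies: as long as the
state distributions agree, a state with positive probability is visited by both. -/
lemma visits_congr {q : S → (∀ j, A j) → ℝ} (hp : IsKernel p) (hq : IsKernel q)
    (h : ∀ s, 0 < visits G p s → 0 < visits G q s → p s = q s) : visits G p = visits G q := by
  have key : ∀ t s, G.disc ^ t * stateProb G p t s = G.disc ^ t * stateProb G q t s := by
    intro t
    induction t with
    | zero => intro s; rfl
    | succ t ih =>
      have hstep : ∀ r : S → (∀ j, A j) → ℝ, ∀ s', G.disc ^ (t + 1) * stateProb G r (t + 1) s' =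
          G.disc * ∑ s, ∑ a, (G.disc ^ t * stateProb G r t s) * r s a *
            (G.trans s a : S → ℝ) s' := by
        intro r s'
        rw [pow_succ, mul_comm (G.disc ^ t), mul_assoc]
        congr 1
        rw [stateProb, mul_sum]
        refine sum_congr rfl fun s _ => ?_
        rw [mul_sum]
        exact sum_congr rfl fun a _ => by ring
      intro s'
      rw [hstep, hstep]
      congr 1
      refine sum_congr rfl fun s _ => ?_
      rw [ih s]
      rcases (mul_nonneg (pow_nonneg G.disc_nonneg t)
        (stateProb_nonneg (G := G) hq t s)).eq_or_lt with h0 | h0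
      · simp [← h0]
      · have hpos : ∀ {r : S → (∀ j, A j) → ℝ}, IsKernel r →
            0 < G.disc ^ t * stateProb G r t s → 0 < visits G r s := fun hr h1 =>
          h1.trans_le ((summable_visits hr s).le_tsum t fun k _ =>
            mul_nonneg (pow_nonneg G.disc_nonneg k) (stateProb_nonneg hr k s))
        rw [h s (hpos hp (by rwa [ih s])) (hpos hq h0)]
  funext s
  exact tsum_congr fun t => key t s

end Kernel

/-! ### Occupancy measure and entropy of a policy of one agent -/

/-- A sum over joint actions as a sum over the opponents' actions and the action of agent `i`. -/
lemma sum_jointAction (f : A i → OppAction A i → ℝ) :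
    ∑ a : ∀ j, A j, f (a i) (oppOf i a) = ∑ b, ∑ x, f x b := by
  rw [sum_comm, ← Fintype.sum_prod_type' (f := f)]
  exact Fintype.sum_equiv (Equiv.piSplitAt i A) _ (fun y => f y.1 y.2) fun a => rfl

omit [Fintype S] in
lemma isKernel_joint (π : Policy S A i) (μ : OppPolicy S A i) : IsKernel (joint π μ) where
  nonneg s a := mul_nonneg ((π s _).2.1 _) ((μ s).2.1 _)
  sum_eq_one s := by
    have h := sum_jointAction (i := i) fun x b =>
      (π s b : A i → ℝ) x * (μ s : OppAction A i → ℝ) b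
    refine h.trans ?_
    simp_rw [← sum_mul, stdSimplex.sum_eq_one, one_mul]
    exact stdSimplex.sum_eq_one (μ s)

/-- The discounted causal entropy averages the Shannon entropies of the action distributions. -/
lemma entropy_eq (G : MarkovGame S A) (μ : OppPolicy S A i) (π : Policy S A i) :
    entropy G μ π = ∑ s, visits G (joint π μ) s *
      ∑ b, (μ s : OppAction A i → ℝ) b * ∑ x, Real.negMulLog ((π s b : A i → ℝ) x) := by
  rw [entropy, expect_eq_sum_visits (isKernel_joint π μ)]
  refine sum_congr rfl fun s _ => ?_
  congr 1
  refine (sum_jointAction (i := i) fun x b => (π s b : A i → ℝ) x *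
    (μ s : OppAction A i → ℝ) b * -Real.log ((π s b : A i → ℝ) x)).trans ?_
  refine sum_congr rfl fun b _ => ?_
  rw [mul_sum]
  exact sum_congr rfl fun x _ => by rw [Real.negMulLog]; ring

omit [Fintype S] in
lemma continuous_joint (μ : OppPolicy S A i) (s : S) (a : ∀ j, A j) :
    Continuous fun π : Policy S A i => joint π μ s a := by
  have h : Continuous fun π : Policy S A i => π s (oppOf i a) :=
    (continuous_apply (oppOf i a)).comp (continuous_apply s)
  exact ((continuous_apply (a i)).comp (continuous_subtype_val.comp h)).mul continuous_const

lemma continuous_visits (G : MarkovGame S A) (μ : OppPolicy S A i) (s : S) :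
    Continuous fun π : Policy S A i => visits G (joint π μ) s := by
  have h : ∀ t s, Continuous fun π : Policy S A i => stateProb G (joint π μ) t s := by
    intro t
    induction t with
    | zero => intro s; exact continuous_const
    | succ t ih =>
      intro s
      exact continuous_finsetSum _ fun x _ => continuous_finsetSum _ fun a _ =>
        ((ih x).mul (continuous_joint μ x a)).mul continuous_const
  exact continuous_tsum (fun t => continuous_const.mul (h t s)) (summable_disc_pow G)
    fun t π => norm_disc_pow_mul_stateProb_le (isKernel_joint π μ) t s

lemma continuous_expect (G : MarkovGame S A) (μ : OppPolicy S A i) (r : Reward S A) :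
    Continuous fun π : Policy S A i => expect G (joint π μ) r := by
  simp_rw [fun π => expect_eq_sum_visits (G := G) (isKernel_joint π μ) r]
  exact continuous_finsetSum _ fun s _ => (continuous_visits G μ s).mul <|
    continuous_finsetSum _ fun a _ => (continuous_joint μ s a).mul continuous_const

lemma continuous_entropy (G : MarkovGame S A) (μ : OppPolicy S A i) :
    Continuous (entropy G μ) := by
  rw [funext (entropy_eq G μ)]
  refine continuous_finsetSum _ fun s _ => (continuous_visits G μ s).mul <|
    continuous_finsetSum _ fun b _ => continuous_const.mul <|
    continuous_finsetSum _ fun x _ => Real.continuous_negMulLog.comp ?_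
  have h : Continuous fun π : Policy S A i => π s b :=
    (continuous_apply b).comp (continuous_apply s)
  exact (continuous_apply x).comp (continuous_subtype_val.comp h)

/-! ### Mixtures of occupancy measures -/

/-- The policy that at state `s` mixes `π₀` and `π₁` with weights `1 - w s` and `w s`. -/
def mixPolicy (w : S → Set.Icc (0 : ℝ) 1) (π₀ π₁ : Policy S A i) : Policy S A i := fun s b =>
  ⟨(1 - (w s : ℝ)) • (π₀ s b : A i → ℝ) + (w s : ℝ) • (π₁ s b : A i → ℝ),
    convex_stdSimplex ℝ (A i) (π₀ s b).2 (π₁ s b).2 (sub_nonneg.2 (w s).2.2) (w s).2.1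
      (sub_add_cancel _ _)⟩

omit [Fintype S] in
lemma mixPolicy_apply (w : S → Set.Icc (0 : ℝ) 1) (π₀ π₁ : Policy S A i) (s : S)
    (b : OppAction A i) (x : A i) : (mixPolicy w π₀ π₁ s b : A i → ℝ) x =
      (1 - (w s : ℝ)) * (π₀ s b : A i → ℝ) x + (w s : ℝ) * (π₁ s b : A i → ℝ) x := rfl

omit [Fintype S] in
lemma joint_mixPolicy (w : S → Set.Icc (0 : ℝ) 1) (π₀ π₁ : Policy S A i) (μ : OppPolicy S A i)
    (s : S) (a : ∀ j, A j) : joint (mixPolicy w π₀ π₁) μ s a =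
      (1 - (w s : ℝ)) * joint π₀ μ s a + (w s : ℝ) * joint π₁ μ s a := by
  rw [joint, mixPolicy_apply, joint, joint]
  ring

lemma exists_mixing_weight {c d : ℝ} (hc : 0 ≤ c) (hd : 0 ≤ d) :
    ∃ w ∈ Set.Icc (0 : ℝ) 1, (1 - w) * (c + d) = c ∧ w * (c + d) = d := by
  rcases (add_nonneg hc hd).eq_or_lt with h | h
  · exact ⟨0, by simp, by linarith, by linarith⟩
  · refine ⟨d / (c + d), ⟨by positivity, (div_le_one h).2 (by linarith)⟩, ?_, ?_⟩ <;>
      field_simp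
    ring

/-- The weights `w` give `mixPolicy w π₀ π₁` the occupancy measure `(1 - t) ρ₀ + t ρ₁`, in the
strong sense that at each state the parts played according to `π₀` and `π₁` have the masses
`(1 - t) d₀` and `t d₁`. -/
structure IsMixture (G : MarkovGame S A) (μ : OppPolicy S A i) (t : ℝ) (π₀ π₁ : Policy S A i)
    (w : S → Set.Icc (0 : ℝ) 1) : Prop where
  left : ∀ s, visits G (joint (mixPolicy w π₀ π₁) μ) s * (1 - (w s : ℝ)) =
    (1 - t) * visits G (joint π₀ μ) s
  right : ∀ s, visits G (joint (mixPolicy w π₀ π₁) μ) s * (w s : ℝ) =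
    t * visits G (joint π₁ μ) s

/-- The occupancy measures of a policy class that is closed under mixing form a convex set: the
measure `(1 - t) ρ₀ + t ρ₁` is that of the policy mixing `π₀` and `π₁` at `s` in proportion
to the masses `(1 - t) d₀(s)` and `t d₁(s)`. The weights depend on the state only, so this
policy ignores the opponents' action if `π₀` and `π₁` do. -/
lemma exists_isMixture (G : MarkovGame S A) (μ : OppPolicy S A i) (π₀ π₁ : Policy S A i) {t : ℝ}
    (ht₀ : 0 ≤ t) (ht₁ : t ≤ 1) :
    ∃ w : S → Set.Icc (0 : ℝ) 1, IsMixture G μ t π₀ π₁ w := by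
  choose w hw h₀ h₁ using fun s => exists_mixing_weight
    (mul_nonneg (sub_nonneg.2 ht₁) (visits_nonneg (G := G) (isKernel_joint π₀ μ) s))
    (mul_nonneg ht₀ (visits_nonneg (G := G) (isKernel_joint π₁ μ) s))
  refine ⟨fun s => ⟨w s, hw s⟩, ?_⟩
  have hv : visits G (joint (mixPolicy (fun s => ⟨w s, hw s⟩) π₀ π₁) μ) = fun s =>
      (1 - t) * visits G (joint π₀ μ) s + t * visits G (joint π₁ μ) s := by
    refine eq_visits_of_flow (isKernel_joint _ _) fun s' => ?_
    have hs : ∀ s, ((1 - t) * visits G (joint π₀ μ) s + t * visits G (joint π₁ μ) s) *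
        ∑ a, joint (mixPolicy (fun s => ⟨w s, hw s⟩) π₀ π₁) μ s a * (G.trans s a : S → ℝ) s' =
        (1 - t) * (visits G (joint π₀ μ) s * ∑ a, joint π₀ μ s a * (G.trans s a : S → ℝ) s') +
        t * (visits G (joint π₁ μ) s * ∑ a, joint π₁ μ s a * (G.trans s a : S → ℝ) s') := by
      intro s
      simp_rw [joint_mixPolicy, add_mul, mul_assoc, sum_add_distrib, ← mul_sum]
      linear_combination (∑ a, joint π₀ μ s a * (G.trans s a : S → ℝ) s') * h₀ s +
        (∑ a, joint π₁ μ s a * (G.trans s a : S → ℝ) s') * h₁ s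
    rw [sum_congr rfl fun s _ => hs s, sum_add_distrib, ← mul_sum, ← mul_sum,
      visits_flow (isKernel_joint π₀ μ) s', visits_flow (isKernel_joint π₁ μ) s']
    ring
  exact ⟨fun s => by rw [hv, mul_comm]; exact h₀ s, fun s => by rw [hv, mul_comm]; exact h₁ s⟩

section Mixture

variable {G : MarkovGame S A} {μ : OppPolicy S A i} {t : ℝ} {π₀ π₁ : Policy S A i}
  {w : S → Set.Icc (0 : ℝ) 1}

lemma IsMixture.expect_eq (h : IsMixture G μ t π₀ π₁ w) (r : Reward S A) :
    expect G (joint (mixPolicy w π₀ π₁) μ) r =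
      (1 - t) * expect G (joint π₀ μ) r + t * expect G (joint π₁ μ) r := by
  simp_rw [expect_eq_sum_visits (isKernel_joint _ μ), mul_sum, ← sum_add_distrib]
  refine sum_congr rfl fun s _ => sum_congr rfl fun a _ => ?_
  rw [joint_mixPolicy]
  linear_combination joint π₀ μ s a * r s a * h.left s + joint π₁ μ s a * r s a * h.right s

lemma entropy_eq_sum (G : MarkovGame S A) (μ : OppPolicy S A i) (π : Policy S A i) :
    entropy G μ π = ∑ s, ∑ b, ∑ x, visits G (joint π μ) s *
      ((μ s : OppAction A i → ℝ) b * Real.negMulLog ((π s b : A i → ℝ) x)) := by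
  simp_rw [entropy_eq, mul_sum]

/-- The entropy gained by a mixture, split into the concavity defects of `negMulLog`. -/
lemma IsMixture.entropy_sub (h : IsMixture G μ t π₀ π₁ w) :
    entropy G μ (mixPolicy w π₀ π₁) - ((1 - t) * entropy G μ π₀ + t * entropy G μ π₁) =
      ∑ s, ∑ b, ∑ x, visits G (joint (mixPolicy w π₀ π₁) μ) s *
        ((μ s : OppAction A i → ℝ) b *
          (Real.negMulLog ((mixPolicy w π₀ π₁ s b : A i → ℝ) x) -
            ((1 - (w s : ℝ)) * Real.negMulLog ((π₀ s b : A i → ℝ) x) +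
              (w s : ℝ) * Real.negMulLog ((π₁ s b : A i → ℝ) x)))) := by
  simp_rw [entropy_eq_sum, mul_sum, ← sum_add_distrib, ← sum_sub_distrib]
  refine sum_congr rfl fun s _ => sum_congr rfl fun b _ => sum_congr rfl fun x _ => ?_
  linear_combination
    (μ s : OppAction A i → ℝ) b * Real.negMulLog ((π₀ s b : A i → ℝ) x) * h.left s +
    (μ s : OppAction A i → ℝ) b * Real.negMulLog ((π₁ s b : A i → ℝ) x) * h.right s

omit [Fintype S] in
lemma mixPolicy_entropy_defect_nonneg (w : S → Set.Icc (0 : ℝ) 1) (π₀ π₁ : Policy S A i) (s : S)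
    (b : OppAction A i) (x : A i) :
    0 ≤ Real.negMulLog ((mixPolicy w π₀ π₁ s b : A i → ℝ) x) -
      ((1 - (w s : ℝ)) * Real.negMulLog ((π₀ s b : A i → ℝ) x) +
        (w s : ℝ) * Real.negMulLog ((π₁ s b : A i → ℝ) x)) :=
  sub_nonneg.2 <| Real.concaveOn_negMulLog.2 (stdSimplex.zero_le (π₀ s b) x)
    (stdSimplex.zero_le (π₁ s b) x) (sub_nonneg.2 (w s).2.2) (w s).2.1 (sub_add_cancel _ _)

lemma visits_mul_entropy_defect_nonneg (G : MarkovGame S A) (μ : OppPolicy S A i)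
    (w : S → Set.Icc (0 : ℝ) 1) (π₀ π₁ : Policy S A i) (s : S) (b : OppAction A i) (x : A i) :
    0 ≤ visits G (joint (mixPolicy w π₀ π₁) μ) s * ((μ s : OppAction A i → ℝ) b *
      (Real.negMulLog ((mixPolicy w π₀ π₁ s b : A i → ℝ) x) -
        ((1 - (w s : ℝ)) * Real.negMulLog ((π₀ s b : A i → ℝ) x) +
          (w s : ℝ) * Real.negMulLog ((π₁ s b : A i → ℝ) x)))) :=
  mul_nonneg (visits_nonneg (isKernel_joint _ μ) s) <|
    mul_nonneg (stdSimplex.zero_le (μ s) b) (mixPolicy_entropy_defect_nonneg w π₀ π₁ s b x)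

/-- The causal entropy is a concave function of the occupancy measure. -/
lemma IsMixture.le_entropy (h : IsMixture G μ t π₀ π₁ w) :
    (1 - t) * entropy G μ π₀ + t * entropy G μ π₁ ≤ entropy G μ (mixPolicy w π₀ π₁) := by
  rw [← sub_nonneg, h.entropy_sub]
  exact sum_nonneg fun s _ => sum_nonneg fun b _ => sum_nonneg fun x _ =>
    visits_mul_entropy_defect_nonneg G μ w π₀ π₁ s b x

/-- The causal entropy is strictly concave: if a proper mixture gains no entropy, then the two
policies agree after every event that has positive probability under both. -/
lemma IsMixture.eq_of_entropy_le (h : IsMixture G μ t π₀ π₁ w) (ht₀ : 0 < t) (ht₁ : t < 1)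
    (hle : entropy G μ (mixPolicy w π₀ π₁) ≤ (1 - t) * entropy G μ π₀ + t * entropy G μ π₁)
    {s : S} (hs₀ : 0 < visits G (joint π₀ μ) s) (hs₁ : 0 < visits G (joint π₁ μ) s)
    {b : OppAction A i} (hb : 0 < (μ s : OppAction A i → ℝ) b) : π₀ s b = π₁ s b := by
  have hnn := visits_mul_entropy_defect_nonneg G μ w π₀ π₁
  have h0 := h.entropy_sub.symm.trans (sub_eq_zero.2 (hle.antisymm h.le_entropy))
  rw [sum_eq_zero_iff_of_nonneg fun s _ => sum_nonneg fun b _ => sum_nonneg fun x _ =>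
    hnn s b x] at h0
  have h1 := h0 s (mem_univ s)
  rw [sum_eq_zero_iff_of_nonneg fun b _ => sum_nonneg fun x _ => hnn s b x] at h1
  have h2 := h1 b (mem_univ b)
  rw [sum_eq_zero_iff_of_nonneg fun x _ => hnn s b x] at h2
  have hV := visits_nonneg (G := G) (isKernel_joint (mixPolicy w π₀ π₁) μ) s
  have hl := h.left s
  have hr := h.right s
  have hl' : 0 < (1 - t) * visits G (joint π₀ μ) s := mul_pos (by linarith) hs₀
  have hr' : 0 < t * visits G (joint π₁ μ) s := mul_pos ht₀ hs₁
  rw [← hl] at hl'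
  rw [← hr] at hr'
  have hw₀ := pos_of_mul_pos_right hl' hV
  have hw₁ := pos_of_mul_pos_right hr' hV
  have hV' := pos_of_mul_pos_left hr' hw₁.le
  refine stdSimplex.ext (funext fun x => ?_)
  by_contra hne
  have h3 := Real.strictConcaveOn_negMulLog.2 (stdSimplex.zero_le (π₀ s b) x)
    (stdSimplex.zero_le (π₁ s b) x) hne hw₀ hw₁ (sub_add_cancel _ _)
  have h4 := mul_pos hV' (mul_pos hb (sub_pos.2 h3))
  exact h4.ne' (h2 x (mem_univ x))

end Mixture

/-- Policies that agree after every event with positive probability under both have the same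
occupancy measure and the same entropy. -/
lemma occupancy_eq_and_entropy_eq {G : MarkovGame S A} {μ : OppPolicy S A i}
    {π₀ π₁ : Policy S A i}
    (h : ∀ s, 0 < visits G (joint π₀ μ) s → 0 < visits G (joint π₁ μ) s →
      ∀ b, 0 < (μ s : OppAction A i → ℝ) b → π₀ s b = π₁ s b) :
    occupancy G (joint π₀ μ) = occupancy G (joint π₁ μ) ∧ entropy G μ π₀ = entropy G μ π₁ := by
  have hj : ∀ s, 0 < visits G (joint π₀ μ) s → 0 < visits G (joint π₁ μ) s →
      joint π₀ μ s = joint π₁ μ s := by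
    intro s h₀ h₁
    funext a
    rcases (stdSimplex.zero_le (μ s) (oppOf i a)).eq_or_lt with hb | hb
    · rw [joint, joint, ← hb, mul_zero, mul_zero]
    · rw [joint, joint, h s h₀ h₁ _ hb]
  have hv := visits_congr (isKernel_joint π₀ μ) (isKernel_joint π₁ μ) hj
  constructor
  · funext s a
    rw [occupancy_apply, occupancy_apply, hv]
    rcases (visits_nonneg (G := G) (isKernel_joint π₁ μ) s).eq_or_lt with h₁ | h₁
    · rw [← h₁, mul_zero, mul_zero]
    · rw [hj s (by rwa [hv]) h₁]
  · rw [entropy_eq, entropy_eq, hv]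
    refine sum_congr rfl fun s _ => ?_
    rcases (visits_nonneg (G := G) (isKernel_joint π₁ μ) s).eq_or_lt with h₁ | h₁
    · rw [← h₁, zero_mul, zero_mul]
    · congr 1
      refine sum_congr rfl fun b _ => ?_
      rcases (stdSimplex.zero_le (μ s) b).eq_or_lt with hb | hb
      · rw [← hb, zero_mul, zero_mul]
      · rw [h s (by rwa [hv]) h₁ b hb]

/-! ### Classes of policies -/

/-- The properties of the two policy classes on which the duality rests: compactness, and closure
under mixing with weights that depend on the state only. -/
structure IsMixingClass (C : Set (Policy S A i)) : Prop where
  isCompact : IsCompact C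
  nonempty : C.Nonempty
  mix_mem : ∀ (w : S → Set.Icc (0 : ℝ) 1), ∀ π₀ ∈ C, ∀ π₁ ∈ C, mixPolicy w π₀ π₁ ∈ C

omit [Fintype S] in
lemma isMixingClass_correlatedPolicies (πE : Policy S A i) :
    IsMixingClass (correlatedPolicies S A i) :=
  ⟨isCompact_univ, ⟨πE, trivial⟩, fun _ _ _ _ _ => trivial⟩

lemma isMixingClass_nonCorrelatedPolicies (G : MarkovGame S A) (πE : Policy S A i)
    (μE : OppPolicy S A i) : IsMixingClass (nonCorrelatedPolicies S A i) where
  isCompact := by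
    refine IsClosed.isCompact ?_
    simp only [nonCorrelatedPolicies, Set.ofPred_forall]
    refine isClosed_iInter fun s => isClosed_iInter fun b => isClosed_iInter fun b' =>
      isClosed_eq ?_ ?_
    · exact (continuous_apply b).comp (continuous_apply s)
    · exact (continuous_apply b').comp (continuous_apply s)
  nonempty := by
    -- probability distributions exist on nonempty types only
    obtain ⟨s, -, -⟩ := exists_ne_zero_of_sum_ne_zero
      (ne_of_eq_of_ne (stdSimplex.sum_eq_one G.init) one_ne_zero)
    obtain ⟨b, -, -⟩ := exists_ne_zero_of_sum_ne_zero
      (ne_of_eq_of_ne (stdSimplex.sum_eq_one (μE s)) one_ne_zero)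
    exact ⟨fun _ _ => πE s b, fun _ _ _ => rfl⟩
  mix_mem w π₀ h₀ π₁ h₁ s b b' := by
    refine stdSimplex.ext (funext fun x => ?_)
    have := mixPolicy_apply w π₀ π₁ s b x
    rw [h₀ s b b', h₁ s b b'] at this
    exact this

/-! ### Reinforcement learning -/

lemma continuous_rlObjective (G : MarkovGame S A) (lam : ℝ) (μ : OppPolicy S A i)
    (r : Reward S A) : Continuous (rlObjective G lam μ r) :=
  (continuous_const.mul (continuous_entropy G μ)).add (continuous_expect G μ r)

lemma RL_nonempty (G : MarkovGame S A) (lam : ℝ) (μ : OppPolicy S A i) {C : Set (Policy S A i)}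
    (hC : IsMixingClass C) (r : Reward S A) : (RL G lam μ C r).Nonempty := by
  obtain ⟨π, hπ, h⟩ := hC.isCompact.exists_isMaxOn hC.nonempty
    (continuous_rlObjective G lam μ r).continuousOn
  exact ⟨π, hπ, h⟩

/-- All maximizers of the regularized objective have the same occupancy measure and the same
entropy, since otherwise the policy with their mean occupancy measure would be better. -/
lemma occupancy_eq_and_entropy_eq_of_mem_RL {G : MarkovGame S A} {lam : ℝ} (hlam : 0 < lam)
    {μ : OppPolicy S A i} {C : Set (Policy S A i)} (hC : IsMixingClass C) {r : Reward S A}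
    {π₀ π₁ : Policy S A i} (h₀ : π₀ ∈ RL G lam μ C r) (h₁ : π₁ ∈ RL G lam μ C r) :
    occupancy G (joint π₀ μ) = occupancy G (joint π₁ μ) ∧ entropy G μ π₀ = entropy G μ π₁ := by
  obtain ⟨w, hw⟩ := exists_isMixture G μ π₀ π₁ (t := 1 / 2) (by norm_num) (by norm_num)
  have hm₀ := h₀.2 _ (hC.mix_mem w π₀ h₀.1 π₁ h₁.1)
  have hm₁ := h₁.2 _ (hC.mix_mem w π₀ h₀.1 π₁ h₁.1)
  simp only [rlObjective, hw.expect_eq] at hm₀ hm₁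
  refine occupancy_eq_and_entropy_eq fun s hs₀ hs₁ b hb =>
    hw.eq_of_entropy_le (by norm_num) (by norm_num) ?_ hs₀ hs₁ hb
  refine le_of_mul_le_mul_left ?_ hlam
  linarith

/-! ### Weak duality -/

section Duality

variable {G : MarkovGame S A} {lam : ℝ} {πE : Policy S A i} {μE : OppPolicy S A i}
  {C : Set (Policy S A i)} {ψ : Reward S A → EReal}

lemma lagrangian_eq_rlObjective (π : Policy S A i) (r : Reward S A) :
    lagrangian G lam πE μE ψ π r =
      ((expect G (joint πE μE) r - rlObjective G lam μE r π : ℝ) : EReal) - ψ r := by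
  rw [lagrangian, rlObjective]
  congr 2
  ring

lemma lagrangian_le_of_mem_RL {r : Reward S A} {π : Policy S A i}
    (hπ : π ∈ RL G lam μE C r) {π' : Policy S A i} (hπ' : π' ∈ C) :
    lagrangian G lam πE μE ψ π r ≤ lagrangian G lam πE μE ψ π' r := by
  rw [lagrangian_eq_rlObjective, lagrangian_eq_rlObjective]
  refine EReal.sub_le_sub (EReal.coe_le_coe_iff.2 ?_) le_rfl
  linarith [hπ.2 π' hπ']

lemma irlObjective_eq_lagrangian {r : Reward S A} {π : Policy S A i}
    (hπ : π ∈ RL G lam μE C r) :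
    irlObjective G lam πE μE C ψ r = lagrangian G lam πE μE ψ π r := by
  have hmax : (⨆ π' ∈ C, ((rlObjective G lam μE r π' : ℝ) : EReal)) =
      ((rlObjective G lam μE r π : ℝ) : EReal) :=
    le_antisymm (iSup₂_le fun π' h => EReal.coe_le_coe_iff.2 (hπ.2 π' h))
      (le_iSup₂ (f := fun π' _ => ((rlObjective G lam μE r π' : ℝ) : EReal)) π hπ.1)
  rw [irlObjective, hmax, lagrangian_eq_rlObjective]
  induction ψ r with
  | bot => simp [sub_eq_add_neg]
  | top => simp [sub_eq_add_neg]
  | coe x =>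
    norm_cast
    ring

lemma irlObjective_eq_iInf (hC : IsMixingClass C) (r : Reward S A) :
    irlObjective G lam πE μE C ψ r = ⨅ π ∈ C, lagrangian G lam πE μE ψ π r := by
  obtain ⟨π, hπ⟩ := RL_nonempty G lam μE hC r
  rw [irlObjective_eq_lagrangian hπ]
  exact le_antisymm (le_iInf₂ fun π' h => lagrangian_le_of_mem_RL hπ h)
    (iInf₂_le π hπ.1)

lemma matchObjective_eq_iSup (π : Policy S A i) :
    matchObjective G lam πE μE ψ π = ⨆ r, lagrangian G lam πE μE ψ π r := by
  have hL : ∀ r, lagrangian G lam πE μE ψ π r = ((-(lam * entropy G μE π) : ℝ) : EReal) +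
      (((∑ s, ∑ a, (occupancy G (joint πE μE) - occupancy G (joint π μE)) s a * r s a : ℝ) :
        EReal) - ψ r) := by
    intro r
    rw [lagrangian, sub_eq_add_neg _ (ψ r), sub_eq_add_neg _ (ψ r), ← add_assoc, ← EReal.coe_add]
    congr 2
    simp only [Pi.sub_apply, sub_mul, sum_sub_distrib,
      ← expect_eq_sum_occupancy (isKernel_joint _ μE)]
    ring
  simp_rw [hL, matchObjective, conjugate]
  refine le_antisymm ?_ (iSup_le fun r => add_le_add_right (le_iSup
    (fun r : Reward S A => ((∑ s, ∑ a, (occupancy G (joint πE μE) -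
      occupancy G (joint π μE)) s a * r s a : ℝ) : EReal) - ψ r) r) _)
  rw [add_comm, ← EReal.le_sub_iff_add_le (.inl (EReal.coe_ne_bot _)) (.inl (EReal.coe_ne_top _))]
  refine iSup_le fun r => ?_
  rw [EReal.le_sub_iff_add_le (.inl (EReal.coe_ne_bot _)) (.inl (EReal.coe_ne_top _)), add_comm]
  exact le_iSup (fun r : Reward S A => ((-(lam * entropy G μE π) : ℝ) : EReal) +
    (((∑ s, ∑ a, (occupancy G (joint πE μE) - occupancy G (joint π μE)) s a * r s a : ℝ) :
      EReal) - ψ r)) r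

lemma irlValue_le_matchValue (hC : IsMixingClass C) :
    irlValue G lam πE μE C ψ ≤ matchValue G lam πE μE C ψ := by
  refine iSup_le fun r => le_iInf₂ fun π hπ => ?_
  rw [irlObjective_eq_iInf hC, matchObjective_eq_iSup]
  exact (iInf₂_le π hπ).trans (le_iSup (fun r => lagrangian G lam πE μE ψ π r) r)

/-! ### Strong duality -/

/-- The Lagrangian as a real number, for rewards at which `ψ` is finite. -/
def realLagrangian (G : MarkovGame S A) (lam : ℝ) (πE : Policy S A i) (μE : OppPolicy S A i)
    (ψ : Reward S A → EReal) (π : Policy S A i) (r : Reward S A) : ℝ :=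
  expect G (joint πE μE) r - rlObjective G lam μE r π - (ψ r).toReal

lemma coe_realLagrangian (hψ : IsProperConvex ψ) (π : Policy S A i) {r : Reward S A}
    (hr : ψ r ≠ ⊤) :
    (realLagrangian G lam πE μE ψ π r : EReal) = lagrangian G lam πE μE ψ π r := by
  rw [lagrangian_eq_rlObjective, realLagrangian, EReal.coe_sub,
    EReal.coe_toReal hr (hψ.ne_bot r)]

omit [Fintype S] [∀ j, Fintype (A j)] in
lemma IsProperConvex.convexOn_toReal (hψ : IsProperConvex ψ) :
    ConvexOn ℝ {r | ψ r ≠ ⊤} fun r => (ψ r).toReal := by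
  have key : ∀ r ∈ {r | ψ r ≠ ⊤}, ∀ r' ∈ {r | ψ r ≠ ⊤}, ∀ a b : ℝ, 0 ≤ a → 0 ≤ b → a + b = 1 →
      ψ (a • r + b • r') ≤ ((a * (ψ r).toReal + b * (ψ r').toReal : ℝ) : EReal) := by
    intro r hr r' hr' a b ha hb hab
    exact hψ.convex_epigraph (x := (r, (ψ r).toReal)) (y := (r', (ψ r').toReal))
      (EReal.coe_toReal hr (hψ.ne_bot r)).ge (EReal.coe_toReal hr' (hψ.ne_bot r')).ge ha hb hab
  have hdom : ∀ r ∈ {r | ψ r ≠ ⊤}, ∀ r' ∈ {r | ψ r ≠ ⊤}, ∀ a b : ℝ, 0 ≤ a → 0 ≤ b → a + b = 1 →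
      ψ (a • r + b • r') ≠ ⊤ := fun r hr r' hr' a b ha hb hab =>
    ((key r hr r' hr' a b ha hb hab).trans_lt (EReal.coe_lt_top _)).ne
  refine ⟨fun r hr r' hr' a b ha hb hab => hdom r hr r' hr' a b ha hb hab, ?_⟩
  intro r hr r' hr' a b ha hb hab
  have h := key r hr r' hr' a b ha hb hab
  rwa [← EReal.coe_toReal (hdom r hr r' hr' a b ha hb hab) (hψ.ne_bot _),
    EReal.coe_le_coe_iff] at h

lemma concaveOn_realLagrangian (hψ : IsProperConvex ψ) (π : Policy S A i) :
    ConcaveOn ℝ {r | ψ r ≠ ⊤} (realLagrangian G lam πE μE ψ π) := by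
  refine ⟨hψ.convexOn_toReal.1, fun r hr r' hr' a b ha hb hab => ?_⟩
  have h := hψ.convexOn_toReal.2 hr hr' ha hb hab
  have hlin : ∀ π : Policy S A i, expect G (joint π μE) (a • r + b • r') =
      a * expect G (joint π μE) r + b * expect G (joint π μE) r' := by
    intro π
    simp_rw [expect_eq_sum_occupancy (isKernel_joint π μE), mul_sum, ← sum_add_distrib]
    refine sum_congr rfl fun s _ => sum_congr rfl fun x _ => ?_
    simp only [Pi.add_apply, Pi.smul_apply, smul_eq_mul]
    ring
  simp only [realLagrangian, rlObjective, hlin, smul_eq_mul] at h ⊢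
  obtain rfl : b = 1 - a := by linarith
  linarith

/-- There is no duality gap: a number below the primal value is beaten by the Lagrangian at
every policy, hence by `exists_forall_le_of_convexlike` at all policies with the same reward. -/
lemma matchValue_le_irlValue (hC : IsMixingClass C) (hlam : 0 ≤ lam) (hψ : IsProperConvex ψ) :
    matchValue G lam πE μE C ψ ≤ irlValue G lam πE μE C ψ := by
  refine EReal.le_of_forall_lt_iff_le.1 fun z hz => ?_
  by_contra! hlt
  obtain ⟨z', hz', hz''⟩ := EReal.lt_iff_exists_real_btwn.1 hlt
  have hα : ∀ π ∈ C, ∃ r ∈ {r | ψ r ≠ ⊤}, z' < realLagrangian G lam πE μE ψ π r := by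
    intro π hπ
    have h := hz''.trans_le (iInf₂_le π hπ)
    rw [matchObjective_eq_iSup, lt_iSup_iff] at h
    obtain ⟨r, hr⟩ := h
    have hr' : ψ r ≠ ⊤ := by
      intro h
      rw [lagrangian, h, EReal.sub_top] at hr
      exact not_lt_bot hr
    exact ⟨r, hr', by rwa [← EReal.coe_lt_coe_iff, coe_realLagrangian hψ π hr']⟩
  have hconv : ∀ π₀ ∈ C, ∀ π₁ ∈ C, ∀ t : ℝ, 0 ≤ t → t ≤ 1 →
      ∃ π ∈ C, ∀ r ∈ {r | ψ r ≠ ⊤}, realLagrangian G lam πE μE ψ π r ≤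
        (1 - t) * realLagrangian G lam πE μE ψ π₀ r + t * realLagrangian G lam πE μE ψ π₁ r := by
    intro π₀ h₀ π₁ h₁ t ht₀ ht₁
    obtain ⟨w, hw⟩ := exists_isMixture G μE π₀ π₁ ht₀ ht₁
    refine ⟨_, hC.mix_mem w π₀ h₀ π₁ h₁, fun r _ => ?_⟩
    have := mul_le_mul_of_nonneg_left hw.le_entropy hlam
    simp only [realLagrangian, rlObjective, hw.expect_eq]
    linarith
  obtain ⟨r, hr, hle⟩ := exists_forall_le_of_convexlike hC.isCompact hC.nonempty
    (fun r _ => ((continuous_const.sub (continuous_rlObjective G lam μE r)).sub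
      continuous_const).continuousOn)
    (fun π _ => concaveOn_realLagrangian hψ π) hconv hα
  have : (z' : EReal) ≤ irlValue G lam πE μE C ψ := by
    refine le_trans ?_ (le_iSup (irlObjective G lam πE μE C ψ) r)
    rw [irlObjective_eq_iInf hC]
    refine le_iInf₂ fun π hπ => ?_
    rw [← coe_realLagrangian hψ π hr, EReal.coe_le_coe_iff]
    exact hle π hπ
  exact absurd (hz.trans_le' this) (not_lt.2 hz'.le)

lemma lowerSemicontinuous_matchObjective (hψ : IsProperConvex ψ) :
    LowerSemicontinuous (matchObjective G lam πE μE ψ) := by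
  rw [show matchObjective G lam πE μE ψ = _ from funext fun π => matchObjective_eq_iSup π]
  refine lowerSemicontinuous_iSup fun r => ?_
  by_cases hr : ψ r = ⊤
  · simp only [lagrangian, hr, EReal.sub_top]
    exact lowerSemicontinuous_const
  · simp_rw [← fun π => coe_realLagrangian (G := G) (lam := lam) (πE := πE) (μE := μE) hψ π hr]
    exact (continuous_coe_real_ereal.comp ((continuous_const.sub
      (continuous_rlObjective G lam μE r)).sub continuous_const)).lowerSemicontinuous

lemma argminOver_matchObjective_nonempty (hC : IsMixingClass C) (hψ : IsProperConvex ψ) :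
    (argminOver C (matchObjective G lam πE μE ψ)).Nonempty := by
  obtain ⟨π, hπ, h⟩ := LowerSemicontinuousOn.exists_isMinOn hC.nonempty hC.isCompact
    ((lowerSemicontinuous_matchObjective (G := G) (lam := lam) (πE := πE) (μE := μE)
      hψ).lowerSemicontinuousOn C)
  exact ⟨π, hπ, h⟩

/-! ### Policies learned from a recovered reward -/

/-- A recovered reward has a finite penalty, since some reward has. -/
lemma ne_top_of_mem_IRL (hC : IsMixingClass C) (hψ : IsProperConvex ψ) {r : Reward S A}
    (hr : r ∈ IRL G lam πE μE C ψ) : ψ r ≠ ⊤ := by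
  intro htop
  obtain ⟨r₀, h₀⟩ := hψ.exists_ne_top
  obtain ⟨π₀, hπ₀⟩ := RL_nonempty G lam μE hC r₀
  obtain ⟨π, hπ⟩ := RL_nonempty G lam μE hC r
  have h := hr r₀
  rw [irlObjective_eq_lagrangian hπ₀, irlObjective_eq_lagrangian hπ, ← coe_realLagrangian hψ π₀ h₀,
    lagrangian, htop, EReal.sub_top, le_bot_iff] at h
  exact EReal.coe_ne_bot _ h

/-- A primal optimum and a dual optimum form a saddle point of the Lagrangian. -/
lemma argminOver_matchObjective_subset_RL (hC : IsMixingClass C) (hlam : 0 ≤ lam)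
    (hψ : IsProperConvex ψ) {r : Reward S A} (hr : r ∈ IRL G lam πE μE C ψ) :
    argminOver C (matchObjective G lam πE μE ψ) ⊆ RL G lam μE C r := by
  rintro π ⟨hπ, hmin⟩
  refine ⟨hπ, fun π' hπ' => ?_⟩
  have hfin := ne_top_of_mem_IRL hC hψ hr
  have h : lagrangian G lam πE μE ψ π r ≤ lagrangian G lam πE μE ψ π' r :=
    calc lagrangian G lam πE μE ψ π r ≤ matchObjective G lam πE μE ψ π := by
          rw [matchObjective_eq_iSup]
          exact le_iSup (fun r => lagrangian G lam πE μE ψ π r) r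
      _ ≤ matchValue G lam πE μE C ψ := le_iInf₂ hmin
      _ ≤ irlValue G lam πE μE C ψ := matchValue_le_irlValue hC hlam hψ
      _ ≤ irlObjective G lam πE μE C ψ r := iSup_le hr
      _ ≤ lagrangian G lam πE μE ψ π' r := by
          rw [irlObjective_eq_iInf hC]
          exact iInf₂_le π' hπ'
  rw [← coe_realLagrangian hψ π hfin, ← coe_realLagrangian hψ π' hfin, EReal.coe_le_coe_iff] at h
  simp only [realLagrangian] at h
  linarith

theorem RL_eq_argminOver_matchObjective (hC : IsMixingClass C) (hlam : 0 < lam)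
    (hψ : IsProperConvex ψ) {r : Reward S A} (hr : r ∈ IRL G lam πE μE C ψ) :
    RL G lam μE C r = argminOver C (matchObjective G lam πE μE ψ) := by
  refine Set.Subset.antisymm (fun π hπ => ?_)
    (argminOver_matchObjective_subset_RL hC hlam.le hψ hr)
  obtain ⟨π₁, h₁⟩ := argminOver_matchObjective_nonempty (G := G) (lam := lam) (πE := πE)
    (μE := μE) hC hψ
  obtain ⟨hocc, hent⟩ := occupancy_eq_and_entropy_eq_of_mem_RL hlam hC hπ
    (argminOver_matchObjective_subset_RL hC hlam.le hψ hr h₁)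
  refine ⟨hπ.1, fun π' hπ' => ?_⟩
  have heq : matchObjective G lam πE μE ψ π = matchObjective G lam πE μE ψ π₁ := by
    rw [matchObjective, matchObjective, hocc, hent]
  rw [heq]
  exact h₁.2 π' hπ'

/-! ### Regularizers of the cost -/

omit [Fintype S] [∀ j, Fintype (A j)] in
lemma IsProperConvex.comp_neg (hψ : IsProperConvex ψ) :
    IsProperConvex fun r : Reward S A => ψ (-r) where
  ne_bot r := hψ.ne_bot (-r)
  exists_ne_top := by
    obtain ⟨r, hr⟩ := hψ.exists_ne_top
    exact ⟨-r, by rwa [neg_neg]⟩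
  convex_epigraph := by
    rintro ⟨r, x⟩ h ⟨r', x'⟩ h' a b ha hb hab
    have := hψ.convex_epigraph (x := (-r, x)) (y := (-r', x')) h h' ha hb hab
    change ψ (a • -r + b • -r') ≤ _ at this
    rwa [smul_neg, smul_neg, ← neg_add] at this

lemma conjugate_comp_neg (ψ : Reward S A → EReal) (x : S → (∀ j, A j) → ℝ) :
    conjugate (fun r => ψ (-r)) x = conjugate ψ (-x) := by
  rw [conjugate, conjugate, ← (Equiv.neg (Reward S A)).iSup_comp]
  simp

lemma costMatchObjective_eq (π : Policy S A i) :
    costMatchObjective G lam πE μE ψ π = matchObjective G lam πE μE (fun r => ψ (-r)) π := by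
  rw [costMatchObjective, matchObjective, conjugate_comp_neg, neg_sub]

end Duality

end CoIRL

end

theorem proposition1 {N : ℕ} {S : Type*} {A : Fin N → Type*} [Fintype S] [∀ j, Fintype (A j)]
    (G : CoIRL.MarkovGame S A) (i : Fin N)
    -- the demonstrator: policy of agent `i` and joint policy of its opponents
    (πE : CoIRL.Policy S A i) (μE : CoIRL.OppPolicy S A i)
    -- the policies available to agent `i`
    (C : Set (CoIRL.Policy S A i))
    (hC : C = CoIRL.correlatedPolicies S A i ∨ C = CoIRL.nonCorrelatedPolicies S A i)
    (lam : ℝ) (hlam : 0 < lam)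
    (ψ : CoIRL.Reward S A → EReal) (hψ : CoIRL.IsProperConvex ψ) :
    -- inverse reinforcement learning is the Lagrangian dual of occupancy measure matching
    (∀ r, CoIRL.irlObjective G lam πE μE C ψ r
        = ⨅ π ∈ C, CoIRL.lagrangian G lam πE μE ψ π r) ∧
    (∀ π ∈ C, CoIRL.matchObjective G lam πE μE ψ π
        = ⨆ r, CoIRL.lagrangian G lam πE μE ψ π r) ∧
    -- without duality gap
    CoIRL.irlValue G lam πE μE C ψ = CoIRL.matchValue G lam πE μE C ψ ∧
    -- the optima over policies are attained
    (∀ r, (CoIRL.RL G lam μE C r).Nonempty) ∧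
    (CoIRL.argminOver C (CoIRL.matchObjective G lam πE μE ψ)).Nonempty ∧
    -- reinforcement learning on a recovered reward returns exactly the primal optima
    (∀ r ∈ CoIRL.IRL G lam πE μE C ψ,
      CoIRL.RL G lam μE C r = CoIRL.argminOver C (CoIRL.matchObjective G lam πE μE ψ)) ∧
    -- the same for a regularizer of the cost `-r`
    (∀ r ∈ CoIRL.IRL G lam πE μE C (fun r' => ψ (-r')),
      CoIRL.RL G lam μE C r = CoIRL.argminOver C (CoIRL.costMatchObjective G lam πE μE ψ)) := by
  have hclass : CoIRL.IsMixingClass C := by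
    rcases hC with rfl | rfl
    · exact CoIRL.isMixingClass_correlatedPolicies πE
    · exact CoIRL.isMixingClass_nonCorrelatedPolicies G πE μE
  refine ⟨CoIRL.irlObjective_eq_iInf hclass, fun π _ => CoIRL.matchObjective_eq_iSup π,
    (CoIRL.irlValue_le_matchValue hclass).antisymm
      (CoIRL.matchValue_le_irlValue hclass hlam.le hψ),
    CoIRL.RL_nonempty G lam μE hclass, CoIRL.argminOver_matchObjective_nonempty hclass hψ,
    fun r hr => CoIRL.RL_eq_argminOver_matchObjective hclass hlam hψ hr, fun r hr => ?_⟩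
  rw [CoIRL.RL_eq_argminOver_matchObjective hclass hlam hψ.comp_neg hr]
  congr 1
  exact funext fun π => (CoIRL.costMatchObjective_eq π).symm
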